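/- Let $(E,d)$ be a complete separable metric space with its Borel $\sigma$-algebra, and let $\mathbb{R}^+=[0,\infty)$. For a metric space $S$ let $D_S(\mathbb{R}^+)$ be the space of c\`adl\`ag paths $x:\mathbb{R}^+\to S$ (right-continuous with left limits) with the Skorokhod ($J_1$) topology, in which $x_n\to x$ if and only if for every $T\ge 0$ there are increasing bijections $\tau_n$ of $\mathbb{R}^+$ with $\sup_{t\le T}|\tau_n(t)-t|\to 0$ and $\sup_{t\le T} d_S\big(x(t),x_n(\tau_n(t))\big)\to 0$. Let $\mathcal{P}(E)$ and $\mathcal{P}(D_E(\mathbb{R}^+))$ be the spaces of Borel probability measures on $E$ and on $D_E(\mathbb{R}^+)$, with the topology of weak convergence; the one on $\mathcal{P}(E)$ is metrized by the Prokhorov metric. For $\mathbb{P}\in\mathcal{P}(D_E(\mathbb{R}^+))$ let $X(t)$ be the coordinate process $X(t)(x)=x(t)$, let $X(t-)(x)=\lim_{s\uparrow t}x(s)$ for $t>0$, and let $$\phi:\mathcal{P}(D_E(\mathbb{R}^+))\to D_{\mathcal{P}(E)}(\mathbb{R}^+),\qquad \phi(\mathbb{P})=\big(\mathbb{P}\circ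 X(t)^{-1}\big)_{t\ge 0},$$ be the map that sends a law on path space to the trajectory of its time marginals (this trajectory is c\`adl\`ag for weak convergence). Then $\phi$ is continuous at every $\mathbb{P}\in\mathcal{P}(D_E(\mathbb{R}^+))$ such that $\mathbb{P}[X(t)=X(t-)]=1$ for every $t>0$. -/

import Mathlib

open MeasureTheory Filter Topology Set
open scoped NNReal

/-- A càdlàg path `[0, ∞) → S`: right-continuous at every time, with left limits. (At `t = 0` the
filter `𝓝[<] t` is trivial, so the second condition says nothing there.) -/
structure CadlagPath (S : Type*) [TopologicalSpace S] where
  toFun : ℝ≥0 → S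
  right_continuous : ∀ t, ContinuousWithinAt toFun (Ici t) t
  left_limit : ∀ t, ∃ l, Tendsto toFun (𝓝[<] t) (𝓝 l)

namespace CadlagPath

instance {S : Type*} [TopologicalSpace S] : CoeFun (CadlagPath S) (fun _ => ℝ≥0 → S) := ⟨toFun⟩

/-- The left limit `x(t-) = lim_{s ↑ t} x(s)` (with `x(0-) = x(0)`). -/
noncomputable def leftLim {S : Type*} [TopologicalSpace S] (x : CadlagPath S) (t : ℝ≥0) : S :=
  Function.leftLim x.toFun t

/-- The pairs of paths `(x, y)` for which there is a time change `τ`, that is, an increasing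
bijection of `[0, ∞)`, such that on the time interval `[0, T]` the time change is `ε`-close to the
identity and `x` is `ε`-close to `y ∘ τ`. -/
def skorokhodEntourage (S : Type*) [PseudoMetricSpace S] (T : ℝ≥0) (ε : ℝ) :
    Set (CadlagPath S × CadlagPath S) :=
  {p | ∃ τ : ℝ≥0 ≃o ℝ≥0, ∀ t ≤ T, dist (τ t) t < ε ∧ dist (p.1 t) (p.2 (τ t)) < ε}

lemma skorokhodEntourage_mono {S : Type*} [PseudoMetricSpace S] {T T' : ℝ≥0} {ε ε' : ℝ}
    (hT : T ≤ T') (hε : ε' ≤ ε) : skorokhodEntourage S T' ε' ⊆ skorokhodEntourage S T ε := by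
  rintro p ⟨τ, h⟩
  exact ⟨τ, fun t ht => ⟨(h t (ht.trans hT)).1.trans_le hε, (h t (ht.trans hT)).2.trans_le hε⟩⟩

/-- The sets `skorokhodEntourage S T ε`, for `T ≥ 0` and `ε > 0`, form a filter basis. -/
def skorokhodBasis (S : Type*) [PseudoMetricSpace S] :
    FilterBasis (CadlagPath S × CadlagPath S) where
  sets := {U | ∃ (T : ℝ≥0) (ε : ℝ), 0 < ε ∧ U = skorokhodEntourage S T ε}
  nonempty := ⟨_, 0, 1, one_pos, rfl⟩
  inter_sets := by
    rintro _ _ ⟨T, ε, hε, rfl⟩ ⟨T', ε', hε', rfl⟩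
    exact ⟨_, ⟨max T T', min ε ε', lt_min hε hε', rfl⟩,
      subset_inter (skorokhodEntourage_mono (le_max_left _ _) (min_le_left _ _))
        (skorokhodEntourage_mono (le_max_right _ _) (min_le_right _ _))⟩

/-- The Skorokhod (`J₁`) topology on the space `D_S([0, ∞))` of càdlàg paths in a metric space `S`,
presented through a uniform structure with basis `skorokhodEntourage S T ε`, `T ≥ 0`, `ε > 0`.
Thus `xₙ → x` if and only if for every `T` there are time changes `τₙ` such that
`sup_{t ≤ T} |τₙ(t) - t| → 0` and `sup_{t ≤ T} d(x(t), xₙ(τₙ(t))) → 0`. -/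
instance skorokhodUniformSpace (S : Type*) [PseudoMetricSpace S] : UniformSpace (CadlagPath S) :=
  UniformSpace.ofCore <| UniformSpace.Core.mkOfBasis (skorokhodBasis S)
    (by
      rintro _ ⟨T, ε, hε, rfl⟩ x
      exact ⟨OrderIso.refl _, fun t _ => by simpa using hε⟩)
    (by
      rintro _ ⟨T, ε, hε, rfl⟩
      refine ⟨_, ⟨T + ⟨ε, hε.le⟩, ε, hε, rfl⟩, ?_⟩
      rintro ⟨x, y⟩ ⟨τ, h⟩
      refine ⟨τ.symm, fun t ht => ?_⟩
      have h1 : τ.symm t ≤ T + ⟨ε, hε.le⟩ := by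
        rw [OrderIso.symm_apply_le]
        have h2 := (h (T + ⟨ε, hε.le⟩) le_rfl).1
        rw [NNReal.dist_eq, abs_lt] at h2
        have h3 : ((T + ⟨ε, hε.le⟩ : ℝ≥0) : ℝ) = T + ε := rfl
        rw [h3] at h2
        refine ht.trans ?_
        rw [← NNReal.coe_le_coe]
        linarith [h2.1]
      have h2 := h _ h1
      simp only [OrderIso.apply_symm_apply] at h2
      exact ⟨by rw [dist_comm]; exact h2.1, by rw [dist_comm]; exact h2.2⟩)
    (by
      rintro _ ⟨T, ε, hε, rfl⟩
      refine ⟨_, ⟨T + ⟨ε, hε.le⟩, ε / 2, half_pos hε, rfl⟩, ?_⟩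
      rintro ⟨x, z⟩ ⟨y, ⟨τ, h⟩, ⟨σ, h'⟩⟩
      refine ⟨τ.trans σ, fun t ht => ?_⟩
      obtain ⟨h1, h2⟩ := h t (ht.trans le_self_add)
      have h3 : τ t ≤ T + ⟨ε, hε.le⟩ := by
        rw [NNReal.dist_eq, abs_lt] at h1
        have h3 : ((T + ⟨ε, hε.le⟩ : ℝ≥0) : ℝ) = T + ε := rfl
        rw [← NNReal.coe_le_coe] at ht ⊢
        rw [h3]
        linarith [h1.2]
      obtain ⟨h4, h5⟩ := h' _ h3
      constructor
      · calc dist (σ (τ t)) t ≤ dist (σ (τ t)) (τ t) + dist (τ t) t := dist_triangle _ _ _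
          _ < ε := by linarith
      · calc dist (x t) (z (σ (τ t))) ≤ dist (x t) (y (τ t)) + dist (y (τ t)) (z (σ (τ t))) :=
              dist_triangle _ _ _
          _ < ε := by linarith)

lemma hasBasis_uniformity (S : Type*) [PseudoMetricSpace S] :
    (uniformity (CadlagPath S)).HasBasis (fun p : ℝ≥0 × ℝ => 0 < p.2)
      (fun p => skorokhodEntourage S p.1 p.2) := by
  refine ⟨fun U => (skorokhodBasis S).mem_filter_iff.trans ⟨?_, ?_⟩⟩
  · rintro ⟨_, ⟨T, ε, hε, rfl⟩, h⟩
    exact ⟨(T, ε), hε, h⟩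
  · rintro ⟨⟨T, ε⟩, hε, h⟩
    exact ⟨_, ⟨T, ε, hε, rfl⟩, h⟩

/-- The Borel σ-algebra of the Skorokhod topology. -/
instance (S : Type*) [PseudoMetricSpace S] : MeasurableSpace (CadlagPath S) := borel _

instance (S : Type*) [PseudoMetricSpace S] : BorelSpace (CadlagPath S) := ⟨rfl⟩

/-- Paths staying in a closed set during an open time interval form a closed set. -/
lemma isClosed_forall_mem {S : Type*} [PseudoMetricSpace S] {C : Set S} (hC : IsClosed C)
    (a b : ℝ≥0) : IsClosed {x : CadlagPath S | ∀ s ∈ Ioo a b, x s ∈ C} := by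
  rw [← isOpen_compl_iff, isOpen_iff_mem_nhds]
  intro x hx
  simp only [mem_compl_iff, mem_ofPred_eq, not_forall] at hx
  obtain ⟨s, hs, hxs⟩ := hx
  obtain ⟨δ, hδ, hball⟩ := Metric.isOpen_iff.1 hC.isOpen_compl _ hxs
  obtain ⟨η, hη, hη'⟩ := Metric.isOpen_iff.1 isOpen_Ioo s hs
  rw [(nhds_basis_uniformity' (hasBasis_uniformity S)).mem_iff]
  refine ⟨(s, min δ η), lt_min hδ hη, ?_⟩
  rintro y ⟨τ, hτ⟩ hy
  obtain ⟨h1, h2⟩ := hτ s le_rfl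
  have h3 : τ s ∈ Ioo a b := hη' (h1.trans_le (min_le_right _ _))
  refine hball ?_ (hy _ h3)
  rw [Metric.mem_ball, dist_comm]
  exact h2.trans_le (min_le_left _ _)

/-- The evaluation `π_t : x ↦ x(t)` is Borel measurable on the Skorokhod space. -/
lemma measurable_eval {S : Type*} [PseudoMetricSpace S] [MeasurableSpace S] [BorelSpace S]
    (t : ℝ≥0) : Measurable (fun x : CadlagPath S => x t) := by
  refine measurable_of_isClosed fun F hF => ?_
  have key : (fun x : CadlagPath S => x t) ⁻¹' F = ⋂ k : ℕ, ⋃ m : ℕ,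
      {x : CadlagPath S | ∀ s ∈ Ioo t (t + 1 / ((m : ℝ≥0) + 1)),
        x s ∈ Metric.cthickening (1 / ((k : ℝ) + 1)) F} := by
    ext x
    simp only [mem_preimage, mem_iInter, mem_iUnion, mem_ofPred_eq]
    constructor
    · intro hx k
      have hk : (0 : ℝ) < 1 / ((k : ℝ) + 1) := by positivity
      have h1 : ∀ᶠ s in 𝓝[≥] t, x s ∈ Metric.cthickening (1 / ((k : ℝ) + 1)) F :=
        (x.right_continuous t).eventually
          (mem_of_superset (Metric.isOpen_thickening.mem_nhds
            (Metric.self_subset_thickening hk F hx)) (Metric.thickening_subset_cthickening _ _))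
      rw [eventually_nhdsWithin_iff, Metric.eventually_nhds_iff] at h1
      obtain ⟨ε, hε, h1⟩ := h1
      obtain ⟨m, hm⟩ := exists_nat_one_div_lt hε
      refine ⟨m, fun s hs => h1 ?_ hs.1.le⟩
      obtain ⟨hs1, hs2⟩ := hs
      rw [← NNReal.coe_lt_coe] at hs1 hs2
      push_cast at hs2
      rw [NNReal.dist_eq, abs_lt]
      constructor <;> linarith
    · intro h
      have hF' := hF.closure_eq
      rw [← hF', Metric.closure_eq_iInter_cthickening' F (range fun k : ℕ => 1 / ((k : ℝ) + 1))]
      · simp only [mem_iInter]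
        rintro _ ⟨k, rfl⟩
        obtain ⟨m, hm⟩ := h k
        have hlt : t < t + 1 / ((m : ℝ≥0) + 1) := lt_add_of_pos_right t (by positivity)
        have hev : ∀ᶠ s in 𝓝[>] t, x s ∈ Metric.cthickening (1 / ((k : ℝ) + 1)) F := by
          filter_upwards [Ioo_mem_nhdsGT hlt] with s hs using hm s hs
        exact Metric.isClosed_cthickening.mem_of_tendsto
          ((x.right_continuous t).mono_left (nhdsWithin_mono t Ioi_subset_Ici_self)) hev
      · intro ε hε
        obtain ⟨k, hk⟩ := exists_nat_one_div_lt hε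
        exact ⟨_, ⟨k, rfl⟩, Nat.one_div_pos_of_nat, hk.le⟩
  rw [key]
  exact MeasurableSet.iInter fun k => MeasurableSet.iUnion fun m =>
    (isClosed_forall_mem Metric.isClosed_cthickening _ _).measurableSet

end CadlagPath

/-- The Prokhorov metric on the space `𝒫(E)` of Borel probability measures on a separable metric
space. Its topology is, definitionally, the topology of weak convergence. -/
noncomputable instance prokhorovMetricSpace (E : Type*) [MetricSpace E]
    [TopologicalSpace.SeparableSpace E] [MeasurableSpace E] [BorelSpace E] :
    MetricSpace (ProbabilityMeasure E) :=
  (MetricSpace.induced (LevyProkhorov.ofMeasure (α := ProbabilityMeasure E))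
    LevyProkhorov.toMeasureEquiv.symm.injective inferInstance).replaceTopology
    LevyProkhorov.probabilityMeasureHomeomorph.isInducing.eq_induced

namespace CadlagPath

variable {E : Type*} [MetricSpace E] [MeasurableSpace E] [BorelSpace E]

/-- The law `φ_t(P) = P ∘ π_t⁻¹` of the time-`t` marginal of a law `P` on path space. -/
noncomputable def marginal (P : ProbabilityMeasure (CadlagPath E)) (t : ℝ≥0) :
    ProbabilityMeasure E :=
  P.map (f := fun x : CadlagPath E => x t) (measurable_eval t).aemeasurable

lemma tendsto_marginal (P : ProbabilityMeasure (CadlagPath E)) {l : Filter ℝ≥0}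
    [l.IsCountablyGenerated] {g : CadlagPath E → E} (hg : Measurable g)
    (h : ∀ x : CadlagPath E, Tendsto x.toFun l (𝓝 (g x))) :
    Tendsto (marginal P) l (𝓝 (P.map hg.aemeasurable)) := by
  rw [ProbabilityMeasure.tendsto_iff_forall_integral_tendsto]
  intro f
  have h1 : ∀ t, ∫ ω, f ω ∂(marginal P t : Measure E) =
      ∫ x : CadlagPath E, f (x t) ∂(P : Measure (CadlagPath E)) := fun t =>
    integral_map (measurable_eval t).aemeasurable
      f.continuous.measurable.stronglyMeasurable.aestronglyMeasurable
  have h2 : ∫ ω, f ω ∂(P.map hg.aemeasurable : Measure E) =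
      ∫ x, f (g x) ∂(P : Measure (CadlagPath E)) :=
    integral_map hg.aemeasurable
      f.continuous.measurable.stronglyMeasurable.aestronglyMeasurable
  simp only [h1, h2]
  refine tendsto_integral_filter_of_dominated_convergence (fun _ => ‖f‖) ?_ ?_
    (integrable_const _) ?_
  · exact Eventually.of_forall fun t =>
      (f.continuous.measurable.comp (measurable_eval t)).stronglyMeasurable.aestronglyMeasurable
  · exact Eventually.of_forall fun t => Eventually.of_forall fun x => f.norm_coe_le_norm _
  · exact Eventually.of_forall fun x => (f.continuous.tendsto _).comp (h x)

/-- The map `φ : 𝒫(D_E([0, ∞))) → D_{𝒫(E)}([0, ∞))` sending a law on path space to the trajectory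
`t ↦ P ∘ π_t⁻¹` of its time marginals. -/
noncomputable def marginalTrajectory [TopologicalSpace.SeparableSpace E]
    (P : ProbabilityMeasure (CadlagPath E)) : CadlagPath (ProbabilityMeasure E) where
  toFun := marginal P
  right_continuous t := tendsto_marginal P (measurable_eval t) fun x => x.right_continuous t
  left_limit t := by
    rcases eq_or_ne t 0 with rfl | ht
    · exact ⟨marginal P 0, by
        have h0 : Iio (0 : ℝ≥0) = ∅ := by ext; simp
        rw [h0, nhdsWithin_empty]; exact tendsto_bot⟩
    · have hne : (𝓝[<] t).NeBot := nhdsLT_neBot_of_exists_lt ⟨0, pos_iff_ne_zero.2 ht⟩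
      have hl : ∀ x : CadlagPath E, Tendsto x.toFun (𝓝[<] t) (𝓝 (x.leftLim t)) :=
        fun x => tendsto_leftLim_of_tendsto (x.left_limit t)
      have hm : Measurable fun x : CadlagPath E => x.leftLim t := by
        refine measurable_of_tendsto_metrizable' (𝓝[<] t) (fun s => measurable_eval s) ?_
        exact tendsto_pi_nhds.2 hl
      exact ⟨_, tendsto_marginal P hm hl⟩

end CadlagPath

open TopologicalSpace
open scoped BoundedContinuousFunction

/-!
Weak convergence passes to the limit in `∫ f (F a x) ∂μ` when both `μ` and `a` vary, as soon as
`F` is jointly continuous at `(a, x)` for almost every `x`: the Lipschitz envelopes of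
`(b, x) ↦ f (F b x)` are bounded continuous minorants that increase to it at such points, and
replacing `b` by `a` in them costs at most a multiple of `dist a b`. The evaluation `(s, x) ↦ x s`
is jointly continuous at `(t, x)` when `x` does not jump at `t`, so `(Q, s) ↦ marginal Q s` is
jointly continuous at every `(P, t)`. By compactness of time intervals the trajectories then
converge locally uniformly, which is Skorokhod convergence without any change of time.
-/

section LipschitzEnvelope

lemma bddBelow_range_of_norm_le {α : Type*} {f : α → ℝ} {c : ℝ} (hf : ∀ a, ‖f a‖ ≤ c) :
    BddBelow (range f) :=
  ⟨-c, forall_mem_range.2 fun a => (abs_le.1 (hf a)).1⟩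

variable {Z : Type*} [PseudoMetricSpace Z] {f : Z → ℝ} {K : ℝ≥0} {c : ℝ} {z w : Z}

/-- The Pasch–Hausdorff envelope of `f`, that is, its largest `K`-Lipschitz minorant. It is
meaningful for `f` bounded below; otherwise the infimum may take the junk value `0`. -/
noncomputable def lipschitzEnvelope (f : Z → ℝ) (K : ℝ≥0) (z : Z) : ℝ :=
  ⨅ w, f w + K * dist z w

lemma le_lipschitzEnvelope_iff (hf : BddBelow (range f)) :
    c ≤ lipschitzEnvelope f K z ↔ ∀ w, c ≤ f w + K * dist z w := by
  have : Nonempty Z := ⟨z⟩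
  obtain ⟨b, hb⟩ := hf
  refine le_ciInf_iff ⟨b, ?_⟩
  rintro _ ⟨w, rfl⟩
  exact (hb (mem_range_self w)).trans (le_add_of_nonneg_right (by positivity))

lemma lipschitzEnvelope_le (hf : BddBelow (range f)) :
    lipschitzEnvelope f K z ≤ f w + K * dist z w :=
  (le_lipschitzEnvelope_iff hf).1 le_rfl w

lemma lipschitzEnvelope_le_self (hf : BddBelow (range f)) : lipschitzEnvelope f K z ≤ f z := by
  simpa using lipschitzEnvelope_le (K := K) (z := z) (w := z) hf

lemma le_lipschitzEnvelope (hf : ∀ w, c ≤ f w) : c ≤ lipschitzEnvelope f K z :=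
  (le_lipschitzEnvelope_iff ⟨c, forall_mem_range.2 hf⟩).2 fun w =>
    (hf w).trans (le_add_of_nonneg_right (by positivity))

lemma lipschitzWith_lipschitzEnvelope (hf : BddBelow (range f)) :
    LipschitzWith K (lipschitzEnvelope f K) := by
  refine LipschitzWith.of_le_add_mul K fun x y => ?_
  rw [← sub_le_iff_le_add, le_lipschitzEnvelope_iff hf]
  intro w
  have hxw : K * dist x w ≤ K * dist x y + K * dist y w := by
    rw [← mul_add]
    gcongr
    exact dist_triangle x y w
  linarith [lipschitzEnvelope_le (K := K) (z := x) (w := w) hf]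

lemma tendsto_lipschitzEnvelope (hf : BddBelow (range f)) (hz : LowerSemicontinuousAt f z) :
    Tendsto (fun n : ℕ => lipschitzEnvelope f n z) atTop (𝓝 (f z)) := by
  refine tendsto_order.2 ⟨fun c hc => ?_, fun c hc => .of_forall fun n => ?_⟩
  · obtain ⟨d, hcd, hdz⟩ := exists_between hc
    obtain ⟨δ, hδ, hball⟩ := Metric.eventually_nhds_iff.1 (hz d hdz)
    obtain ⟨b, hb⟩ := hf
    have hlarge : ∀ᶠ n : ℕ in atTop, d - b ≤ n * δ :=
      (tendsto_natCast_atTop_atTop.atTop_mul_const hδ).eventually_ge_atTop _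
    filter_upwards [hlarge] with n hn
    refine hcd.trans_le ((le_lipschitzEnvelope_iff ⟨b, hb⟩).2 fun w => ?_)
    -- near `z` semicontinuity bounds `f w`; far from `z` the penalty exceeds `d - b`
    rcases lt_or_ge (dist w z) δ with hw | hw
    · exact (hball hw).le.trans (le_add_of_nonneg_right (by positivity))
    · have hpenalty : (n : ℝ) * δ ≤ n * dist z w := by
        rw [dist_comm z w]
        gcongr
      have hbw : b ≤ f w := hb (mem_range_self w)
      push_cast
      linarith
  · exact (lipschitzEnvelope_le_self hf).trans_lt hc

lemma norm_lipschitzEnvelope_le (hf : ∀ w, ‖f w‖ ≤ c) : ‖lipschitzEnvelope f K z‖ ≤ c :=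
  abs_le.2 ⟨le_lipschitzEnvelope fun w => (abs_le.1 (hf w)).1,
    (lipschitzEnvelope_le_self (bddBelow_range_of_norm_le hf)).trans (abs_le.1 (hf z)).2⟩

end LipschitzEnvelope

section ContinuousMapping

variable {ι X Y A : Type*} {l : Filter ι} [TopologicalSpace Y] [MeasurableSpace Y]
  [OpensMeasurableSpace Y] [MeasurableSpace X] {μ : ProbabilityMeasure X}
  {μs : ι → ProbabilityMeasure X} {a : A} {as : ι → A}

lemma integral_lipschitzEnvelope_le [PseudoMetricSpace X] [OpensMeasurableSpace X]
    [PseudoMetricSpace A] {h : A × X → ℝ} {C : ℝ} (hC : ∀ p, ‖h p‖ ≤ C) {b : A}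
    (h_meas : Measurable fun x => h (b, x)) (K : ℝ≥0) (a : A) :
    ∫ x, lipschitzEnvelope h K (a, x) ∂(μ : Measure X) ≤
      ∫ x, h (b, x) ∂(μ : Measure X) + K * dist a b := by
  have h_bddBelow : BddBelow (range h) := bddBelow_range_of_norm_le hC
  have h_int : Integrable (fun x => h (b, x)) (μ : Measure X) :=
    .of_bound h_meas.aestronglyMeasurable C (.of_forall fun x => hC (b, x))
  have env_cont : Continuous fun x => lipschitzEnvelope h K (a, x) :=
    (lipschitzWith_lipschitzEnvelope h_bddBelow).continuous.comp (by fun_prop)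
  have env_int : Integrable (fun x => lipschitzEnvelope h K (a, x)) (μ : Measure X) :=
    .of_bound env_cont.measurable.aestronglyMeasurable C
      (.of_forall fun x => norm_lipschitzEnvelope_le hC)
  calc ∫ x, lipschitzEnvelope h K (a, x) ∂(μ : Measure X)
      ≤ ∫ x, (h (b, x) + K * dist a b) ∂(μ : Measure X) :=
        integral_mono env_int (h_int.add (integrable_const _)) fun x => by
          simpa using lipschitzEnvelope_le (K := K) (z := (a, x)) (w := (b, x)) h_bddBelow
    _ = ∫ x, h (b, x) ∂(μ : Measure X) + K * dist a b := by
        rw [integral_add h_int (integrable_const _)]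
        simp

lemma integral_le_liminf_integral_of_lowerSemicontinuousAt [l.NeBot] [PseudoMetricSpace X]
    [OpensMeasurableSpace X] [PseudoMetricSpace A] {h : A × X → ℝ} {C : ℝ}
    (hC : ∀ p, ‖h p‖ ≤ C) (h_meas : ∀ b, Measurable fun x => h (b, x))
    (h_lsc : ∀ᵐ x ∂(μ : Measure X), LowerSemicontinuousAt h (a, x))
    (hμ : Tendsto μs l (𝓝 μ)) (ha : Tendsto as l (𝓝 a)) :
    ∫ x, h (a, x) ∂(μ : Measure X) ≤ l.liminf fun i => ∫ x, h (as i, x) ∂(μs i : Measure X) := by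
  have h_bddBelow : BddBelow (range h) := bddBelow_range_of_norm_le hC
  let env (n : ℕ) : X →ᵇ ℝ := .ofNormedAddCommGroup (fun x => lipschitzEnvelope h n (a, x))
    ((lipschitzWith_lipschitzEnvelope h_bddBelow).continuous.comp (by fun_prop)) C
    fun x => norm_lipschitzEnvelope_le hC
  have tendsto_integral_env : Tendsto (fun n => ∫ x, env n x ∂(μ : Measure X)) atTop
      (𝓝 (∫ x, h (a, x) ∂(μ : Measure X))) :=
    tendsto_integral_of_dominated_convergence (fun _ => C)
      (fun n => (env n).continuous.measurable.aestronglyMeasurable) (integrable_const C)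
      (fun n => .of_forall fun x => norm_lipschitzEnvelope_le hC)
      (h_lsc.mono fun x hx => tendsto_lipschitzEnvelope h_bddBelow hx)
  refine le_of_tendsto' tendsto_integral_env fun n => ?_
  have tendsto_sub : Tendsto (fun i => ∫ x, env n x ∂(μs i : Measure X) - n * dist a (as i)) l
      (𝓝 (∫ x, env n x ∂(μ : Measure X))) := by
    simpa using (ProbabilityMeasure.tendsto_iff_forall_integral_tendsto.1 hμ (env n)).sub
      (((tendsto_const_nhds (x := a)).dist ha).const_mul (n : ℝ))
  have integral_le (i : ι) : ∫ x, h (as i, x) ∂(μs i : Measure X) ≤ C :=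
    (le_abs_self _).trans <| by
      simpa using norm_integral_le_of_norm_le_const (μ := (μs i : Measure X))
        (.of_forall fun x => hC (as i, x))
  calc ∫ x, env n x ∂(μ : Measure X)
      = l.liminf fun i => ∫ x, env n x ∂(μs i : Measure X) - n * dist a (as i) :=
        tendsto_sub.liminf_eq.symm
    _ ≤ l.liminf fun i => ∫ x, h (as i, x) ∂(μs i : Measure X) :=
        liminf_le_liminf
          (.of_forall fun i => sub_le_iff_le_add.2
            (integral_lipschitzEnvelope_le hC (h_meas (as i)) n a))
          tendsto_sub.isBoundedUnder_ge (isBoundedUnder_of ⟨C, integral_le⟩).isCoboundedUnder_ge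

theorem tendsto_map_of_ae_continuousAt [TopologicalSpace X] [PseudoMetrizableSpace X]
    [OpensMeasurableSpace X] [TopologicalSpace A] [PseudoMetrizableSpace A] {F : A → X → Y}
    (hF : ∀ b, Measurable (F b))
    (hcont : ∀ᵐ x ∂(μ : Measure X), ContinuousAt (Function.uncurry F) (a, x))
    (hμ : Tendsto μs l (𝓝 μ)) (ha : Tendsto as l (𝓝 a)) :
    Tendsto (fun i => (μs i).map (hF (as i)).aemeasurable) l
      (𝓝 (μ.map (hF a).aemeasurable)) := by
  rcases l.eq_or_neBot with rfl | hl
  · exact tendsto_bot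
  let := pseudoMetrizableSpacePseudoMetric X
  let := pseudoMetrizableSpacePseudoMetric A
  rw [ProbabilityMeasure.tendsto_iff_forall_integral_tendsto]
  refine BoundedContinuousFunction.tendsto_integral_of_forall_integral_le_liminf_integral
    fun f _ => ?_
  have integral_map_eq (ν : ProbabilityMeasure X) (b : A) :
      ∫ y, f y ∂(ν.map (hF b).aemeasurable : Measure Y) = ∫ x, f (F b x) ∂(ν : Measure X) :=
    integral_map (hF b).aemeasurable f.continuous.measurable.aestronglyMeasurable
  simp only [integral_map_eq]
  exact integral_le_liminf_integral_of_lowerSemicontinuousAt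
    (h := fun p => f (F p.1 p.2)) (fun p => f.norm_coe_le_norm _)
    (fun b => f.continuous.measurable.comp (hF b))
    (hcont.mono fun x hx => (f.continuous.continuousAt.comp hx).lowerSemicontinuousAt) hμ ha

end ContinuousMapping

namespace CadlagPath

section Skorokhod

variable {S : Type*} [PseudoMetricSpace S] {x : CadlagPath S} {t : ℝ≥0}

instance isCountablyGenerated_uniformity :
    (uniformity (CadlagPath S)).IsCountablyGenerated := by
  refine HasBasis.isCountablyGenerated (ι := ℕ) (p := fun _ => True)
    (s := fun n => skorokhodEntourage S n (1 / ((n : ℝ) + 1))) ?_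
  refine (hasBasis_uniformity S).to_hasBasis ?_ fun n _ => ⟨(n, _), by positivity, subset_rfl⟩
  rintro ⟨T, ε⟩ hε
  obtain ⟨n, hn⟩ := exists_nat_ge T
  obtain ⟨m, hm⟩ := exists_nat_one_div_lt hε
  refine ⟨max n m, trivial, skorokhodEntourage_mono (hn.trans ?_) (le_trans ?_ hm.le)⟩
  · exact_mod_cast le_max_left n m
  · exact one_div_le_one_div_of_le (by positivity) (by gcongr; exact le_max_right n m)

lemma continuousAt_eval (hx : ContinuousAt x t) :
    ContinuousAt (fun p : ℝ≥0 × CadlagPath S => p.2 p.1) (t, x) := by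
  rw [Metric.continuousAt_iff']
  intro ε hε
  obtain ⟨δ, hδ, hball⟩ := Metric.continuousAt_iff.1 hx (ε / 2) (half_pos hε)
  have htime : ∀ᶠ s in 𝓝 t, dist s t < δ / 2 ∧ s ≤ t + 1 :=
    (Metric.eventually_nhds_iff_ball.2 ⟨δ / 2, half_pos hδ, fun _ h => h⟩).and
      (eventually_le_nhds (lt_add_one t))
  have hpath : ∀ᶠ y in 𝓝 x, (y, x) ∈ skorokhodEntourage S (t + 1) (min (δ / 2) (ε / 2)) :=
    (nhds_basis_uniformity (hasBasis_uniformity S)).mem_of_mem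
      (i := (t + 1, min (δ / 2) (ε / 2))) (lt_min (half_pos hδ) (half_pos hε))
  rw [nhds_prod_eq]
  filter_upwards [htime.prod_mk hpath]
  rintro ⟨s, y⟩ ⟨⟨hst, hs⟩, τ, hτ⟩
  obtain ⟨hτs, hys⟩ := hτ s hs
  have hτt : dist (τ s) t < δ := by
    linarith [dist_triangle (τ s) s t, hτs.trans_le (min_le_left _ _)]
  calc dist (y s) (x t) ≤ dist (y s) (x (τ s)) + dist (x (τ s)) (x t) := dist_triangle _ _ _
    _ < ε / 2 + ε / 2 := add_lt_add (hys.trans_le (min_le_right _ _)) (hball hτt)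
    _ = ε := add_halves ε

lemma tendsto_of_tendstoLocallyUniformly {ι : Type*} {l : Filter ι} {xs : ι → CadlagPath S}
    (h : TendstoLocallyUniformly (fun i => xs i) x l) : Tendsto xs l (𝓝 x) := by
  refine (nhds_basis_uniformity' (hasBasis_uniformity S)).tendsto_right_iff.2 ?_
  rintro ⟨T, ε⟩ hε
  have hT : TendstoUniformlyOn (fun i => xs i) x l (Icc 0 T) :=
    (tendstoLocallyUniformlyOn_iff_tendstoUniformlyOn_of_compact isCompact_Icc).1
      h.tendstoLocallyUniformlyOn
  filter_upwards [Metric.tendstoUniformlyOn_iff.1 hT ε hε] with i hi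
  exact ⟨OrderIso.refl _, fun t ht => ⟨by simpa using hε, hi t ⟨zero_le, ht⟩⟩⟩

end Skorokhod

section Jumps

variable {S : Type*} [TopologicalSpace S] (x : CadlagPath S) (t : ℝ≥0)

lemma tendsto_leftLim : Tendsto x (𝓝[<] t) (𝓝 (x.leftLim t)) :=
  tendsto_leftLim_of_tendsto (x.left_limit t)

variable {x t} in
lemma continuousAt_of_eq_leftLim (h : x t = x.leftLim t) : ContinuousAt x t :=
  continuousAt_iff_continuous_left'_right'.2
    ⟨by simpa only [ContinuousWithinAt, h] using x.tendsto_leftLim t,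
      (x.right_continuous t).mono Ioi_subset_Ici_self⟩

lemma leftLim_zero : x.leftLim 0 = x 0 :=
  leftLim_eq_of_isBot isBot_bot

end Jumps

section Marginals

lemma measurable_leftLim {S : Type*} [PseudoMetricSpace S] [MeasurableSpace S] [BorelSpace S]
    (t : ℝ≥0) : Measurable fun x : CadlagPath S => x.leftLim t := by
  rcases (𝓝[<] t).eq_or_neBot with h | h
  · simpa only [leftLim, leftLim_eq_of_eq_bot _ h] using! measurable_eval t
  · exact measurable_of_tendsto_metrizable' (𝓝[<] t) measurable_eval
      (tendsto_pi_nhds.2 fun x => x.tendsto_leftLim t)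

variable {E : Type*} [MetricSpace E] [MeasurableSpace E] [BorelSpace E]
  {P : ProbabilityMeasure (CadlagPath E)} {t : ℝ≥0}

lemma continuousAt_marginal
    (hP : ∀ᵐ x : CadlagPath E ∂(P : Measure (CadlagPath E)), ContinuousAt x t) :
    ContinuousAt (fun q : ProbabilityMeasure (CadlagPath E) × ℝ≥0 => marginal q.1 q.2) (P, t) :=
  tendsto_map_of_ae_continuousAt measurable_eval (hP.mono fun _ => continuousAt_eval)
    continuousAt_fst continuousAt_snd

variable [SeparableSpace E]

lemma ae_continuousAt (hP : P {x : CadlagPath E | x t = x.leftLim t} = 1) :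
    ∀ᵐ x : CadlagPath E ∂(P : Measure (CadlagPath E)), ContinuousAt x t := by
  have : SecondCountableTopology E := UniformSpace.secondCountable_of_separable E
  have hmeas : MeasurableSet {x : CadlagPath E | x t = x.leftLim t} :=
    measurableSet_eq_fun (measurable_eval t) (measurable_leftLim t)
  have hae : ∀ᵐ x : CadlagPath E ∂(P : Measure (CadlagPath E)), x t = x.leftLim t :=
    (mem_ae_iff_prob_eq_one hmeas).2 <| by
      rw [← ProbabilityMeasure.ennreal_coeFn_eq_coeFn_toMeasure, hP, ENNReal.coe_one]
  exact hae.mono fun _ => continuousAt_of_eq_leftLim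

lemma tendstoLocallyUniformly_marginal
    (hP : ∀ t, ∀ᵐ x : CadlagPath E ∂(P : Measure (CadlagPath E)), ContinuousAt x t) :
    TendstoLocallyUniformly marginal (marginal P) (𝓝 P) := by
  refine tendstoLocallyUniformly_iff_forall_tendsto.2 fun t => ?_
  rw [← nhds_prod_eq]
  have hlimit : ContinuousAt
      (fun q : ProbabilityMeasure (CadlagPath E) × ℝ≥0 => marginal P q.2) (P, t) :=
    (continuousAt_marginal (hP t)).comp_of_eq
      (f := fun q : ProbabilityMeasure (CadlagPath E) × ℝ≥0 => (P, q.2)) (by fun_prop) rfl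
  have hjoint := hlimit.prodMk (continuousAt_marginal (hP t))
  exact hjoint.tendsto.mono_right (nhds_le_uniformity _)

end Marginals

end CadlagPath

theorem mainTheorem12_general {E : Type*} [MetricSpace E]
    [TopologicalSpace.SeparableSpace E] [MeasurableSpace E] [BorelSpace E]
    (P : ProbabilityMeasure (CadlagPath E))
    (hP : ∀ t : ℝ≥0, 0 < t → P {x : CadlagPath E | x t = x.leftLim t} = 1) :
    ContinuousAt
      (CadlagPath.marginalTrajectory :
        ProbabilityMeasure (CadlagPath E) → CadlagPath (ProbabilityMeasure E)) P := by
  refine CadlagPath.tendsto_of_tendstoLocallyUniformly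
    (CadlagPath.tendstoLocallyUniformly_marginal fun t => CadlagPath.ae_continuousAt ?_)
  rcases eq_zero_or_pos t with rfl | ht
  · simp [CadlagPath.leftLim_zero]
  · exact hP t ht

theorem mainTheorem12 {E : Type*} [MetricSpace E] [CompleteSpace E]
    [TopologicalSpace.SeparableSpace E] [MeasurableSpace E] [BorelSpace E]
    (P : ProbabilityMeasure (CadlagPath E))
    (hP : ∀ t : ℝ≥0, 0 < t → P {x : CadlagPath E | x t = x.leftLim t} = 1) :
    ContinuousAt
      (CadlagPath.marginalTrajectory :
        ProbabilityMeasure (CadlagPath E) → CadlagPath (ProbabilityMeasure E)) P :=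
  mainTheorem12_general P hP
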